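/- Let $(V,E,\mu)$ be an infinite, connected, locally finite weighted graph: $\mu : V\times V\to[0,\infty)$, $\mu(x,y)=\mu_{xy}$, is symmetric, $\mu_{xy}>0$ if and only if $(x,y)\in E$ (written $x\sim y$; loops $x\sim x$ are permitted), and every vertex has only finitely many neighbours. Put $$\mu(x)=\sum_{y\sim x}\mu_{xy},\qquad \mu(A)=\sum_{x\in A}\mu(x)\quad(A\subset V),\qquad \Delta u(x)=\frac1{\mu(x)}\sum_{y\sim x}\mu_{xy}\bigl(u(y)-u(x)\bigr)$$ for $u:V\to\mathbb R$, and let $B(o,n)=\{x\in V: d(o,x)\le n\}$ be the closed ball for the graph distance $d$ (the minimal number of edges of a path). Let $q>1$ be real. If, for some $o\in V$, $$\sum_{n=1}^{\infty}\frac{n^{2q-1}}{\mu(B(o,n))^{q-1}}=\infty ,$$ then every function $u:V\to[0,\infty)$ with $-\Delta u(x)\ge u(x)^q$ for all $x\in V$ is identically zero. -/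

import Mathlib

/-- A weighted graph `(V, E, μ)`: `Adj x y` says that `(x, y)` is an edge, and `weight` is a
symmetric nonnegative edge weight which is positive exactly on the edges.  Loops are allowed. -/
structure WeightedGraph (V : Type*) where
  Adj : V → V → Prop
  weight : V → V → ℝ
  weight_nonneg : ∀ x y, 0 ≤ weight x y
  weight_symm : ∀ x y, weight x y = weight y x
  weight_pos_iff : ∀ x y, 0 < weight x y ↔ Adj x y

namespace WeightedGraph

variable {V : Type*} (G : WeightedGraph V)

theorem adj_symm {x y : V} (h : G.Adj x y) : G.Adj y x := by
  rw [← G.weight_pos_iff] at h ⊢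
  rwa [G.weight_symm]

/-- The underlying simple graph.  Forgetting loops changes neither connectedness nor the graph
distance. -/
def toSimpleGraph : SimpleGraph V where
  Adj x y := x ≠ y ∧ G.Adj x y
  symm := ⟨fun _ _ h => ⟨h.1.symm, G.adj_symm h.2⟩⟩
  loopless := ⟨fun _ h => h.1 rfl⟩

/-- Every vertex has finitely many neighbours. -/
def LocallyFinite : Prop := ∀ x, {y | G.Adj x y}.Finite

/-- Any two vertices are joined by a path. -/
def Connected : Prop := G.toSimpleGraph.Connected

/-- The vertex weight `μ(x) = ∑_{y ∼ x} μ_{xy}` (a finite sum in a locally finite graph). -/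
noncomputable def vertexWeight (x : V) : ℝ := ∑ᶠ y ∈ {y | G.Adj x y}, G.weight x y

/-- The closed ball `B(o, r)` for the graph distance (of a connected graph). -/
def closedBall (o : V) (r : ℕ) : Set V := {x | G.toSimpleGraph.dist o x ≤ r}

/-- The volume `μ(B(o, r)) = ∑_{x ∈ B(o, r)} μ(x)`; balls in a connected, locally finite graph
are finite. -/
noncomputable def ballVolume (o : V) (r : ℕ) : ℝ := ∑ᶠ x ∈ G.closedBall o r, G.vertexWeight x

/-- The Laplace operator `Δu(x) = μ(x)⁻¹ ∑_{y ∼ x} μ_{xy} (u(y) - u(x))`. -/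
noncomputable def laplacian (u : V → ℝ) (x : V) : ℝ :=
  (G.vertexWeight x)⁻¹ * ∑ᶠ y ∈ {y | G.Adj x y}, G.weight x y * (u y - u x)

end WeightedGraph

/-!
Suppose that a solution `u` is not identically zero; then `u > 0` by the minimum principle. Fix a
large ball `Ω = B(o, N)` and let `h` be its Dirichlet Green function with pole `o`, scaled so that
`-Δh = u(o) ^ q` at `o`; then `h ≤ u`. The proof compares two bounds on the mass of `h ^ q`.

*Upper bound.* `∑_Ω μ h ^ q` is bounded independently of `N`
(`sum_vertexWeight_mul_rpow_le`). The function `k = h ^ q u ^ (1 - q)` is jointly convex in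
`(u, h)`, so that `Δk ≥ q (h / u) ^ (q - 1) Δh - (q - 1) (h / u) ^ q Δu`, where
`-(h / u) ^ q Δu ≥ h ^ q`; and `∑_Ω μ Δk ≤ 0` because `k ≥ 0` vanishes off `Ω`.

*Lower bound.* The flux of `h` through every sphere around `o` is the same. Averaging it over
`r ≤ d ≤ 2 r`, Cauchy–Schwarz bounds its square by `r ^ (-2)` times the product of
`∑ |∇h| ^ 2 h ^ (-s)` and `∑ μ h ^ s`, for an exponent `1 < s < 2`, `s ≤ q`. Since `h` is
superharmonic and `s > 1`, a Caccioppoli inequality (`caccioppoli`) bounds the first factor by a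
multiple of `r ^ (-2) ∑ μ h ^ (2 - s)` over `2 r ≤ d ≤ 4 r`; in it the gradient on an edge is
weighted by the larger of the two values of `h`, so no bound on the ratio of `h` at adjacent
vertices is needed. Hölder's inequality then gives
`∑_{r ≤ d ≤ 4 r} μ h ^ q ≥ c r ^ (2 q) / μ(B(o, 4 r)) ^ (q - 1)` (`mul_rpow_le_sum_mul_rpow`).

Summing over `r = 2 ^ k`, where the annuli overlap at most three times, bounds the dyadic form of
the volume series (`exists_dyadic_sum_bound`), hence the series itself.
-/

namespace WeightedGraph

variable {V : Type*} {G : WeightedGraph V}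

/-! ### Balls, vertex weights and the Laplacian as finite sums -/

lemma weight_eq_zero {x y : V} (h : ¬ G.Adj x y) : G.weight x y = 0 :=
  le_antisymm (not_lt.1 fun h' => h ((G.weight_pos_iff x y).1 h')) (G.weight_nonneg x y)

/-- A sum over the neighbours of `x` may be taken over any finite set containing them. -/
lemma finsum_adj_eq_sum {x : V} {S : Finset V} (hS : ∀ y, G.Adj x y → y ∈ S) {F : V → ℝ}
    (hF : ∀ y, G.weight x y = 0 → F y = 0) :
    ∑ᶠ y ∈ {y | G.Adj x y}, F y = ∑ y ∈ S, F y := by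
  rw [finsum_mem_eq_sum_of_inter_support_eq (t := S)]
  ext y
  simp only [Set.mem_inter_iff, Set.mem_ofPred_eq, Function.mem_support, Finset.mem_coe]
  constructor
  · rintro ⟨h1, h2⟩
    exact ⟨hS y h1, h2⟩
  · rintro ⟨-, h2⟩
    exact ⟨by_contra fun h => h2 (hF y (weight_eq_zero h)), h2⟩

lemma vertexWeight_eq_sum {x : V} {S : Finset V} (hS : ∀ y, G.Adj x y → y ∈ S) :
    G.vertexWeight x = ∑ y ∈ S, G.weight x y :=
  finsum_adj_eq_sum hS fun _ h => h

lemma sum_weight_le_vertexWeight (hfin : G.LocallyFinite) (x : V) (S : Finset V) :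
    ∑ y ∈ S, G.weight x y ≤ G.vertexWeight x := by
  classical
  rw [vertexWeight_eq_sum (S := S ∪ (hfin x).toFinset) (by simp; tauto)]
  exact Finset.sum_le_sum_of_subset_of_nonneg Finset.subset_union_left
    fun _ _ _ => G.weight_nonneg _ _

lemma vertexWeight_nonneg (x : V) : 0 ≤ G.vertexWeight x :=
  finsum_nonneg fun _ => finsum_nonneg fun _ => G.weight_nonneg _ _

lemma exists_adj [Infinite V] (hconn : G.Connected) (x : V) : ∃ y, G.Adj x y := by
  have : G.toSimpleGraph.Preconnected := hconn.preconnected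
  obtain ⟨y, hy⟩ := this.exists_adj_of_nontrivial x
  exact ⟨y, hy.2⟩

lemma vertexWeight_pos [Infinite V] (hconn : G.Connected) (hfin : G.LocallyFinite) (x : V) :
    0 < G.vertexWeight x := by
  obtain ⟨y, hy⟩ := exists_adj hconn x
  refine lt_of_lt_of_le ((G.weight_pos_iff x y).2 hy) ?_
  simpa using sum_weight_le_vertexWeight hfin x {y}

lemma vertexWeight_mul_neg_laplacian [Infinite V] (hconn : G.Connected) (hfin : G.LocallyFinite)
    (f : V → ℝ) {x : V} {S : Finset V} (hS : ∀ y, G.Adj x y → y ∈ S) :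
    G.vertexWeight x * -G.laplacian f x = ∑ y ∈ S, G.weight x y * (f x - f y) := by
  rw [laplacian, finsum_adj_eq_sum hS (fun y h => by simp [h]), ← mul_neg,
    mul_inv_cancel_left₀ (vertexWeight_pos hconn hfin x).ne', ← Finset.sum_neg_distrib]
  exact Finset.sum_congr rfl fun _ _ => by ring

lemma dist_le_dist_add_one (hconn : G.Connected) (o : V) {x y : V} (h : G.Adj x y) :
    G.toSimpleGraph.dist o y ≤ G.toSimpleGraph.dist o x + 1 := by
  by_cases hxy : x = y
  · subst hxy; omega
  · have h1 : G.toSimpleGraph.dist x y = 1 := SimpleGraph.dist_eq_one_iff_adj.2 ⟨hxy, h⟩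
    have h2 := hconn.dist_triangle (u := o) (v := x) (w := y)
    omega

lemma exists_adj_dist_eq (hconn : G.Connected) (o : V) {x : V} {n : ℕ}
    (hx : G.toSimpleGraph.dist o x = n + 1) :
    ∃ y, G.Adj x y ∧ G.toSimpleGraph.dist o y = n := by
  obtain ⟨p, hp⟩ := hconn.exists_walk_length_eq_dist x o
  rw [SimpleGraph.dist_comm, hx] at hp
  cases p with
  | nil => simp at hp
  | cons hadj p =>
    rename_i y
    refine ⟨y, hadj.2, ?_⟩
    have h1 : G.toSimpleGraph.dist y o ≤ n := by
      have := SimpleGraph.dist_le p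
      simp at hp; omega
    have h2 := dist_le_dist_add_one hconn o (G.adj_symm hadj.2)
    rw [SimpleGraph.dist_comm] at h1
    omega

lemma finite_closedBall (hconn : G.Connected) (hfin : G.LocallyFinite) (o : V) (n : ℕ) :
    (G.closedBall o n).Finite := by
  induction n with
  | zero =>
    refine (Set.finite_singleton o).subset fun x hx => ?_
    have : G.toSimpleGraph.dist o x = 0 := Nat.le_zero.1 hx
    exact ((hconn.dist_eq_zero_iff).1 this).symm
  | succ n ih =>
    refine (ih.union (ih.biUnion fun x _ => hfin x)).subset fun x hx => ?_
    rcases Nat.lt_or_ge n (G.toSimpleGraph.dist o x) with h | h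
    · have hx' : G.toSimpleGraph.dist o x = n + 1 := le_antisymm hx h
      obtain ⟨y, hy, hd⟩ := exists_adj_dist_eq hconn o hx'
      exact Or.inr (Set.mem_biUnion (show y ∈ G.closedBall o n from hd.le) (G.adj_symm hy))
    · exact Or.inl h

/-- A property that passes from a vertex to its neighbours passes to the whole graph. -/
lemma forall_of_adj (hconn : G.Connected) {P : V → Prop} (hP : ∀ x y, P x → G.Adj x y → P y)
    {x : V} (hx : P x) (y : V) : P y := by
  obtain ⟨p⟩ := hconn.preconnected x y
  induction p with
  | nil => exact hx
  | cons h p ih => exact ih (hP _ _ hx h.2)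

/-! ### The minimum principle and the Dirichlet problem -/

/-- Strong minimum principle at a vertex. -/
lemma eq_of_adj_of_isMin [Infinite V] (hconn : G.Connected) (hfin : G.LocallyFinite) {f : V → ℝ}
    {x : V} (hmin : ∀ y, G.Adj x y → f x ≤ f y) (hf : 0 ≤ -G.laplacian f x) {y : V}
    (hy : G.Adj x y) : f y = f x := by
  have hS : ∀ y, G.Adj x y → y ∈ (hfin x).toFinset := by simp
  have h := mul_nonneg (vertexWeight_nonneg (G := G) x) hf
  rw [vertexWeight_mul_neg_laplacian hconn hfin f hS] at h
  have hle : ∀ z ∈ (hfin x).toFinset, G.weight x z * (f x - f z) ≤ 0 := fun z hz =>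
    mul_nonpos_of_nonneg_of_nonpos (G.weight_nonneg _ _)
      (sub_nonpos.2 (hmin z (by simpa using hz)))
  have h0 := (Finset.sum_eq_zero_iff_of_nonpos hle).1 (le_antisymm (Finset.sum_nonpos hle) h) y
    (hS y hy)
  have := (G.weight_pos_iff x y).2 hy
  rcases mul_eq_zero.1 h0 with h | h <;> linarith

lemma nonneg_of_superharmonicOn [Infinite V] (hconn : G.Connected) (hfin : G.LocallyFinite)
    {f : V → ℝ} (Ω : Finset V) (hout : ∀ x ∉ Ω, 0 ≤ f x)
    (hf : ∀ x ∈ Ω, 0 ≤ -G.laplacian f x) (x : V) : 0 ≤ f x := by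
  by_contra! hx
  have hxΩ : x ∈ Ω := by_contra fun h => absurd (hout x h) (not_le.2 hx)
  obtain ⟨z, hz, hmin⟩ := Ω.exists_min_image f ⟨x, hxΩ⟩
  have hz0 : f z < 0 := (hmin x hxΩ).trans_lt hx
  have hmin' : ∀ y, f z ≤ f y := fun y => by
    by_cases hy : y ∈ Ω
    · exact hmin y hy
    · exact hz0.le.trans (hout y hy)
  -- The minimum spreads to all vertices, whereas `f ≥ 0` off the finite set `Ω`.
  have hall : ∀ y, f y = f z := forall_of_adj hconn (P := fun y => f y = f z)
    (fun a b ha hab => by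
      have haΩ : a ∈ Ω := by_contra fun h => absurd (hout a h) (by rw [ha]; exact not_le.2 hz0)
      rw [eq_of_adj_of_isMin hconn hfin (fun y _ => ha.symm ▸ hmin' y) (hf a haΩ) hab, ha]) rfl
  obtain ⟨y, hy⟩ := Infinite.exists_notMem_finset Ω
  exact absurd (hout y hy) (by rw [hall y]; exact not_le.2 hz0)

lemma pos_of_superharmonic [Infinite V] (hconn : G.Connected) (hfin : G.LocallyFinite)
    {u : V → ℝ} (hu : ∀ x, 0 ≤ u x) (hsuper : ∀ x, 0 ≤ -G.laplacian u x) {z : V} (hz : u z ≠ 0)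
    (x : V) : 0 < u x := by
  refine (hu x).lt_of_ne' fun hx => hz ?_
  refine forall_of_adj hconn (P := fun y => u y = 0) (fun a b ha hab => ?_) hx z
  rw [eq_of_adj_of_isMin hconn hfin (fun y _ => ha.symm ▸ hu y) (hsuper a) hab, ha]

lemma laplacian_add (hfin : G.LocallyFinite) (f g : V → ℝ) (x : V) :
    G.laplacian (f + g) x = G.laplacian f x + G.laplacian g x := by
  have hS : ∀ y, G.Adj x y → y ∈ (hfin x).toFinset := by simp
  simp only [laplacian]
  rw [finsum_adj_eq_sum hS (fun y h => by simp [h]), finsum_adj_eq_sum hS (fun y h => by simp [h]),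
    finsum_adj_eq_sum hS (fun y h => by simp [h]), ← mul_add, ← Finset.sum_add_distrib]
  congr 1
  exact Finset.sum_congr rfl fun _ _ => by simp only [Pi.add_apply]; ring

lemma laplacian_smul (hfin : G.LocallyFinite) (c : ℝ) (f : V → ℝ) (x : V) :
    G.laplacian (c • f) x = c * G.laplacian f x := by
  have hS : ∀ y, G.Adj x y → y ∈ (hfin x).toFinset := by simp
  simp only [laplacian]
  rw [finsum_adj_eq_sum hS (fun y h => by simp [h]), finsum_adj_eq_sum hS (fun y h => by simp [h]),
    mul_left_comm]
  congr 1
  rw [Finset.mul_sum]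
  exact Finset.sum_congr rfl fun _ _ => by simp only [Pi.smul_apply, smul_eq_mul]; ring

lemma laplacian_neg (hfin : G.LocallyFinite) (f : V → ℝ) (x : V) :
    G.laplacian (-f) x = -G.laplacian f x := by
  rw [← neg_one_smul ℝ f, laplacian_smul hfin, neg_one_mul]

/-- The Dirichlet problem on a finite set is solvable: uniqueness, by the minimum principle, gives
existence because the problem is a square linear system. -/
lemma exists_dirichlet_solution [Infinite V] (hconn : G.Connected) (hfin : G.LocallyFinite)
    (Ω : Finset V) (F : V → ℝ) :
    ∃ h : V → ℝ, (∀ x ∉ Ω, h x = 0) ∧ ∀ x ∈ Ω, -G.laplacian h x = F x := by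
  classical
  let ext : (Ω → ℝ) →ₗ[ℝ] (V → ℝ) := Function.ExtendByZero.linearMap ℝ (Subtype.val : Ω → V)
  have hext : ∀ (f : Ω → ℝ), ∀ x ∉ Ω, ext f x = 0 := fun f x hx =>
    Function.extend_apply' _ _ _ (by rintro ⟨y, rfl⟩; exact hx y.2)
  have hext' : ∀ (f : Ω → ℝ) (x : Ω), ext f x = f x := fun f x =>
    Subtype.val_injective.extend_apply _ _ _
  let T : (Ω → ℝ) →ₗ[ℝ] (Ω → ℝ) :=
    { toFun := fun f x => -G.laplacian (ext f) x
      map_add' := fun f g => by ext x; simp [laplacian_add hfin]; ring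
      map_smul' := fun c f => by ext x; simp [laplacian_smul hfin] }
  have hinj : Function.Injective T := by
    rw [← LinearMap.ker_eq_bot, LinearMap.ker_eq_bot']
    intro f hf
    have hf0 : ∀ x ∈ Ω, -G.laplacian (ext f) x = 0 := fun x hx => congrFun hf ⟨x, hx⟩
    ext x
    have h1 := nonneg_of_superharmonicOn hconn hfin Ω (fun x hx => (hext f x hx).ge)
      (fun x hx => (hf0 x hx).ge) x
    have h2 := nonneg_of_superharmonicOn hconn hfin (f := -ext f) Ω
      (fun x hx => by simp [hext f x hx])
      (fun x hx => by rw [laplacian_neg hfin, hf0 x hx, neg_zero]) x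
    rw [hext'] at h1
    simp only [Pi.neg_apply, hext'] at h2
    simp only [Pi.zero_apply]
    linarith
  obtain ⟨f, hf⟩ := LinearMap.surjective_of_injective hinj fun x => F x
  exact ⟨ext f, hext f, fun x hx => congrFun hf ⟨x, hx⟩⟩

/-- A zero of `h` in the ball would propagate along a geodesic to the centre, where `-Δh > 0`. -/
lemma dirichlet_solution_pos_on_ball [Infinite V] (hconn : G.Connected) (hfin : G.LocallyFinite)
    {o : V} {N : ℕ} {h : V → ℝ} (hout : ∀ x ∉ G.closedBall o N, h x = 0)
    (hsuper : ∀ x ∈ G.closedBall o N, 0 ≤ -G.laplacian h x) (ho : 0 < -G.laplacian h o) :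
    ∀ x ∈ G.closedBall o N, 0 < h x := by
  have hnn : ∀ x, 0 ≤ h x := nonneg_of_superharmonicOn hconn hfin
    (finite_closedBall hconn hfin o N).toFinset (fun x hx => (hout x (by simpa using hx)).ge)
    (fun x hx => hsuper x (by simpa using hx))
  have hmem : o ∈ G.closedBall o N := by simp [closedBall]
  have hadj : ∀ x ∈ G.closedBall o N, h x = 0 → ∀ y, G.Adj x y → h y = 0 := fun x hx hx0 y hy => by
    rw [eq_of_adj_of_isMin hconn hfin (fun y _ => hx0.symm ▸ hnn y) (hsuper x hx) hy, hx0]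
  have hpos_o : h o ≠ 0 := fun h0 => by
    have hS : ∀ y, G.Adj o y → y ∈ (hfin o).toFinset := by simp
    have h1 := mul_pos (vertexWeight_pos hconn hfin o) ho
    rw [vertexWeight_mul_neg_laplacian hconn hfin h hS, Finset.sum_eq_zero] at h1
    · exact lt_irrefl _ h1
    · intro y hy
      rw [h0, hadj o hmem h0 y (by simpa using hy), sub_zero, mul_zero]
  have key : ∀ n x, G.toSimpleGraph.dist o x = n → n ≤ N → h x ≠ 0 := by
    intro n
    induction n with
    | zero =>
      intro x hx _
      rwa [← hconn.dist_eq_zero_iff.1 hx]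
    | succ n ih =>
      intro x hx hn h0
      obtain ⟨y, hy, hd⟩ := exists_adj_dist_eq hconn o hx
      exact ih y hd (by omega) (hadj x (show _ ≤ N from hx.trans_le hn) h0 y hy)
  exact fun x hx => (hnn x).lt_of_ne' (key _ x rfl hx)

/-! ### Summation by parts -/

lemma sum_mul_sub_mul_sub (f ψ : V → ℝ) (S : Finset V) :
    ∑ x ∈ S, ∑ y ∈ S, G.weight x y * ((f x - f y) * (ψ x - ψ y)) =
      2 * ∑ x ∈ S, ψ x * ∑ y ∈ S, G.weight x y * (f x - f y) := by
  have h1 : ∑ x ∈ S, ψ x * ∑ y ∈ S, G.weight x y * (f x - f y) =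
      ∑ x ∈ S, ∑ y ∈ S, G.weight x y * ((f x - f y) * ψ x) := by
    refine Finset.sum_congr rfl fun x _ => ?_
    rw [Finset.mul_sum]
    exact Finset.sum_congr rfl fun y _ => by ring
  have h2 : ∑ x ∈ S, ∑ y ∈ S, G.weight x y * ((f x - f y) * ψ x) =
      ∑ x ∈ S, ∑ y ∈ S, G.weight x y * ((f y - f x) * ψ y) := by
    rw [Finset.sum_comm]
    exact Finset.sum_congr rfl fun x _ => Finset.sum_congr rfl fun y _ => by
      rw [G.weight_symm]
  rw [h1, two_mul]
  nth_rw 2 [h2]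
  simp only [← Finset.sum_add_distrib]
  exact Finset.sum_congr rfl fun x _ => Finset.sum_congr rfl fun y _ => by ring

/-- Green's formula for a test function `ψ` vanishing off the finite set `Ω`; the finite set `S`
contains `Ω` and all neighbours of `Ω`. -/
lemma green_formula [Infinite V] (hconn : G.Connected) (hfin : G.LocallyFinite) (f : V → ℝ)
    {ψ : V → ℝ} {Ω S : Finset V} (hΩS : Ω ⊆ S) (hS : ∀ x ∈ Ω, ∀ y, G.Adj x y → y ∈ S)
    (hψ : ∀ x ∉ Ω, ψ x = 0) :
    ∑ x ∈ S, ∑ y ∈ S, G.weight x y * ((f x - f y) * (ψ x - ψ y)) =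
      2 * ∑ x ∈ Ω, ψ x * (G.vertexWeight x * -G.laplacian f x) := by
  rw [sum_mul_sub_mul_sub, ← Finset.sum_subset hΩS (fun x _ hx => by rw [hψ x hx, zero_mul])]
  congr 1
  refine Finset.sum_congr rfl fun x hx => ?_
  rw [vertexWeight_mul_neg_laplacian hconn hfin f (hS x hx)]

/-! ### The mass bound -/

/-- Young's inequality in the form of a tangent line bound for the convex function `b ↦ b ^ q`. -/
lemma young_tangent {q a b : ℝ} (hq : 1 < q) (ha : 0 ≤ a) (hb : 0 ≤ b) :
    q * a ^ (q - 1) * b ≤ (q - 1) * a ^ q + b ^ q := by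
  have hq0 : 0 < q := by linarith
  have h := Real.geom_mean_le_arith_mean2_weighted (w₁ := (q - 1) / q) (w₂ := 1 / q)
    (div_nonneg (by linarith) hq0.le) (by positivity) (Real.rpow_nonneg ha q)
    (Real.rpow_nonneg hb q) (by field_simp; ring)
  rw [← Real.rpow_mul ha, ← Real.rpow_mul hb, mul_div_cancel₀ _ hq0.ne', mul_div_cancel₀ _ hq0.ne',
    Real.rpow_one] at h
  have h' := mul_le_mul_of_nonneg_left h hq0.le
  have e : q * ((q - 1) / q * a ^ q + 1 / q * b ^ q) = (q - 1) * a ^ q + b ^ q := by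
    field_simp
  linarith

/-- If `u > 0` solves the inequality `-Δu ≥ u ^ q`, the Dirichlet Green function `h` of a finite
set `Ω`, with pole at `o` and scaled so that `h o ≤ u o`, satisfies a bound on `∑ μ h ^ q` that does
not depend on `Ω`. The function `k = u (h / u) ^ q` is jointly convex in `(u, h)`, so `Δk` is at
least the linearised combination of `Δu` and `Δh`; and `∑ μ Δk ≤ 0` on `Ω`, as `k ≥ 0` vanishes
off `Ω`. -/
lemma sum_vertexWeight_mul_rpow_le [Infinite V] (hconn : G.Connected) (hfin : G.LocallyFinite)
    {q : ℝ} (hq : 1 < q) {u h : V → ℝ} (hu : ∀ x, 0 < u x)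
    (hsol : ∀ x, u x ^ q ≤ -G.laplacian u x) (hh : ∀ x, 0 ≤ h x) {Ω S : Finset V} (hΩS : Ω ⊆ S)
    (hS : ∀ x ∈ Ω, ∀ y, G.Adj x y → y ∈ S) (hout : ∀ x ∉ Ω, h x = 0) {o : V} (hoΩ : o ∈ Ω)
    (ho : 0 ≤ -G.laplacian h o) (hharm : ∀ x ∈ Ω, x ≠ o → -G.laplacian h x = 0)
    (hle : h o ≤ u o) :
    (q - 1) * ∑ x ∈ Ω, G.vertexWeight x * h x ^ q ≤
      q * (G.vertexWeight o * -G.laplacian h o) := by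
  have hq0 : 0 < q := by linarith
  set t : V → ℝ := fun x => h x / u x with ht
  have ht0 : ∀ x, 0 ≤ t x := fun x => div_nonneg (hh x) (hu x).le
  have hht : ∀ x, h x = u x * t x := fun x => (mul_div_cancel₀ _ (hu x).ne').symm
  set k : V → ℝ := fun x => u x * t x ^ q with hk
  have hk0 : ∀ x, 0 ≤ k x := fun x => mul_nonneg (hu x).le (Real.rpow_nonneg (ht0 x) q)
  have hkout : ∀ x ∉ Ω, k x = 0 := fun x hx => by
    simp [hk, ht, hout x hx, Real.zero_rpow hq0.ne']
  have hpt : ∀ x y, (q - 1) * t x ^ q * (u x - u y) - q * t x ^ (q - 1) * (h x - h y) ≤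
      k y - k x := fun x y => by
    have hy := mul_le_mul_of_nonneg_left (young_tangent hq (ht0 x) (ht0 y)) (hu y).le
    have e : t x ^ (q - 1) * t x = t x ^ q := by
      rw [← Real.rpow_add_one' (ht0 x) (by linarith), sub_add_cancel]
    simp only [hk]
    rw [hht x, hht y]
    linear_combination hy - q * u x * e
  have hvertex : ∀ x ∈ Ω, (q - 1) * (G.vertexWeight x * h x ^ q) -
      q * t x ^ (q - 1) * (G.vertexWeight x * -G.laplacian h x) ≤
      ∑ y ∈ S, G.weight x y * (k y - k x) := fun x hx => by
    have e1 : h x ^ q = t x ^ q * u x ^ q := by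
      rw [← Real.mul_rpow (ht0 x) (hu x).le, hht x, mul_comm]
    have e2 : G.vertexWeight x * u x ^ q ≤ G.vertexWeight x * -G.laplacian u x :=
      mul_le_mul_of_nonneg_left (hsol x) (vertexWeight_nonneg x)
    have e3 := mul_le_mul_of_nonneg_left e2
      (mul_nonneg (sub_nonneg.2 hq.le) (Real.rpow_nonneg (ht0 x) q))
    calc _ ≤ (q - 1) * t x ^ q * (G.vertexWeight x * -G.laplacian u x) -
          q * t x ^ (q - 1) * (G.vertexWeight x * -G.laplacian h x) := by
            rw [e1]; linarith
      _ = ∑ y ∈ S, G.weight x y *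
          ((q - 1) * t x ^ q * (u x - u y) - q * t x ^ (q - 1) * (h x - h y)) := by
            rw [vertexWeight_mul_neg_laplacian hconn hfin u (hS x hx),
              vertexWeight_mul_neg_laplacian hconn hfin h (hS x hx), Finset.mul_sum,
              Finset.mul_sum, ← Finset.sum_sub_distrib]
            exact Finset.sum_congr rfl fun y _ => by ring
      _ ≤ _ := Finset.sum_le_sum fun y _ =>
            mul_le_mul_of_nonneg_left (hpt x y) (G.weight_nonneg _ _)
  have hantisymm : ∑ x ∈ S, ∑ y ∈ S, G.weight x y * (k y - k x) = 0 := by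
    have h1 : ∑ x ∈ S, ∑ y ∈ S, G.weight x y * (k y - k x) =
        -∑ x ∈ S, ∑ y ∈ S, G.weight x y * (k y - k x) := by
      nth_rw 1 [Finset.sum_comm]
      simp only [← Finset.sum_neg_distrib]
      exact Finset.sum_congr rfl fun x _ => Finset.sum_congr rfl fun y _ => by
        rw [G.weight_symm]; ring
    linarith
  have hflux : ∑ x ∈ Ω, ∑ y ∈ S, G.weight x y * (k y - k x) ≤ 0 := by
    rw [← hantisymm]
    refine Finset.sum_le_sum_of_subset_of_nonneg hΩS fun x _ hx => Finset.sum_nonneg fun y _ => ?_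
    rw [hkout x hx, sub_zero]
    exact mul_nonneg (G.weight_nonneg _ _) (hk0 y)
  have hsum := (Finset.sum_le_sum hvertex).trans hflux
  rw [Finset.sum_sub_distrib, ← Finset.mul_sum, Finset.sum_eq_single_of_mem
    (f := fun x => q * t x ^ (q - 1) * (G.vertexWeight x * -G.laplacian h x)) o hoΩ
    (fun x hx hxo => by rw [hharm x hx hxo]; ring)] at hsum
  have hto : t o ^ (q - 1) ≤ 1 :=
    Real.rpow_le_one (ht0 o) ((div_le_one (hu o)).2 hle) (by linarith)
  have := mul_le_mul_of_nonneg_right hto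
    (mul_nonneg hq0.le (mul_nonneg (vertexWeight_nonneg (G := G) o) ho))
  linarith

/-! ### Cutoff functions -/

/-- The radial cutoff function equal to `1` on `B(o, r)`, to `0` off `B(o, 2r)`, and affine in the
distance in between. -/
noncomputable def cutoff (G : WeightedGraph V) (o : V) (r : ℕ) (x : V) : ℝ :=
  max 0 (min 1 (2 - G.toSimpleGraph.dist o x / r))

lemma cutoff_nonneg (o : V) (r : ℕ) (x : V) : 0 ≤ G.cutoff o r x := le_max_left _ _

lemma cutoff_eq_one {o : V} {r : ℕ} (hr : 0 < r) {x : V} (hx : G.toSimpleGraph.dist o x ≤ r) :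
    G.cutoff o r x = 1 := by
  have hr' : (0 : ℝ) < r := by exact_mod_cast hr
  have : (G.toSimpleGraph.dist o x : ℝ) / r ≤ 1 := (div_le_one hr').2 (by exact_mod_cast hx)
  rw [cutoff, min_eq_left (by linarith), max_eq_right zero_le_one]

lemma cutoff_eq_zero {o : V} {r : ℕ} (hr : 0 < r) {x : V}
    (hx : 2 * r ≤ G.toSimpleGraph.dist o x) : G.cutoff o r x = 0 := by
  have hr' : (0 : ℝ) < r := by exact_mod_cast hr
  have : 2 ≤ (G.toSimpleGraph.dist o x : ℝ) / r := (le_div_iff₀ hr').2 (by exact_mod_cast hx)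
  rw [cutoff, max_eq_left ((min_le_right _ _).trans (by linarith))]

lemma abs_cutoff_sub_le (hconn : G.Connected) (o : V) (r : ℕ) {x y : V} (h : G.Adj x y) :
    |G.cutoff o r x - G.cutoff o r y| ≤ (r : ℝ)⁻¹ := by
  have hdist : |(2 - (G.toSimpleGraph.dist o x : ℝ) / r) - (2 - (G.toSimpleGraph.dist o y : ℝ) / r)|
      ≤ (r : ℝ)⁻¹ := by
    have h1 : (G.toSimpleGraph.dist o y : ℝ) ≤ G.toSimpleGraph.dist o x + 1 := by
      exact_mod_cast dist_le_dist_add_one hconn o h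
    have h2 : (G.toSimpleGraph.dist o x : ℝ) ≤ G.toSimpleGraph.dist o y + 1 := by
      exact_mod_cast dist_le_dist_add_one hconn o (G.adj_symm h)
    have e : (2 - (G.toSimpleGraph.dist o x : ℝ) / r) - (2 - (G.toSimpleGraph.dist o y : ℝ) / r) =
        ((G.toSimpleGraph.dist o y : ℝ) - G.toSimpleGraph.dist o x) * (r : ℝ)⁻¹ := by ring
    rw [e, abs_mul, abs_of_nonneg (a := (r : ℝ)⁻¹) (inv_nonneg.2 (Nat.cast_nonneg r))]
    refine mul_le_of_le_one_left (inv_nonneg.2 (Nat.cast_nonneg r)) (abs_le.2 ⟨?_, ?_⟩) <;> linarith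
  have hmax := abs_max_sub_max_le_max (0 : ℝ) (min 1 (2 - (G.toSimpleGraph.dist o x : ℝ) / r)) 0
    (min 1 (2 - (G.toSimpleGraph.dist o y : ℝ) / r))
  have hmin := abs_min_sub_min_le_max (1 : ℝ) (2 - (G.toSimpleGraph.dist o x : ℝ) / r) 1
    (2 - (G.toSimpleGraph.dist o y : ℝ) / r)
  rw [sub_self, abs_zero, max_eq_right (a := (0 : ℝ)) (abs_nonneg _)] at hmax hmin
  exact hmax.trans (hmin.trans hdist)

/-- The cutoff function varies only along edges inside the closed annulus. -/
lemma mem_annulus_of_cutoff_ne (hconn : G.Connected) {o : V} {r : ℕ} (hr : 0 < r) {x y : V}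
    (h : G.Adj x y) (hne : G.cutoff o r x ≠ G.cutoff o r y) :
    r ≤ G.toSimpleGraph.dist o x ∧ G.toSimpleGraph.dist o x ≤ 2 * r := by
  have h1 := dist_le_dist_add_one hconn o h
  have h2 := dist_le_dist_add_one hconn o (G.adj_symm h)
  constructor
  · by_contra! hlt
    exact hne (by rw [cutoff_eq_one hr hlt.le, cutoff_eq_one hr (by omega)])
  · by_contra! hlt
    exact hne (by rw [cutoff_eq_zero hr hlt.le, cutoff_eq_zero hr (by omega)])

open Classical in
/-- The energy of the cutoff function, weighted by a power of `h`: its gradient is at most `1 / r`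
and lives on edges with both ends in the annulus. The power may be evaluated at the larger of the
two values of `h`, since that value is taken at one of the two ends. -/
lemma sum_weight_mul_rpow_mul_cutoff_sub_sq_le (hconn : G.Connected) (hfin : G.LocallyFinite)
    (o : V) {r : ℕ} (hr : 0 < r) {h : V → ℝ} (hh : ∀ x, 0 ≤ h x) (p : ℝ) {S A : Finset V}
    (hA : ∀ x, r ≤ G.toSimpleGraph.dist o x → G.toSimpleGraph.dist o x ≤ 2 * r → x ∈ A) :
    ∑ x ∈ S, ∑ y ∈ S, G.weight x y *
        (max (h x) (h y) ^ p * (G.cutoff o r x - G.cutoff o r y) ^ 2) ≤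
      2 * ((r : ℝ)⁻¹ ^ 2 * ∑ x ∈ A, G.vertexWeight x * h x ^ p) := by
  set F : V → ℝ := fun x => if x ∈ A then h x ^ p else 0 with hF
  have hF0 : ∀ x, 0 ≤ F x := fun x => by
    simp only [hF]; split_ifs
    · exact Real.rpow_nonneg (hh x) p
    · exact le_rfl
  have hpt : ∀ x y, G.weight x y *
      (max (h x) (h y) ^ p * (G.cutoff o r x - G.cutoff o r y) ^ 2) ≤
      G.weight x y * ((r : ℝ)⁻¹ ^ 2 * F x) + G.weight x y * ((r : ℝ)⁻¹ ^ 2 * F y) := fun x y => by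
    rw [← mul_add, ← mul_add]
    by_cases hxy : G.Adj x y
    · refine mul_le_mul_of_nonneg_left ?_ (G.weight_nonneg _ _)
      by_cases hne : G.cutoff o r x = G.cutoff o r y
      · rw [hne, sub_self, zero_pow two_ne_zero, mul_zero]
        exact mul_nonneg (sq_nonneg _) (add_nonneg (hF0 x) (hF0 y))
      · have hx := mem_annulus_of_cutoff_ne hconn hr hxy hne
        have hy := mem_annulus_of_cutoff_ne hconn hr (G.adj_symm hxy) (Ne.symm hne)
        have hFx : F x = h x ^ p := if_pos (hA x hx.1 hx.2)
        have hFy : F y = h y ^ p := if_pos (hA y hy.1 hy.2)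
        have hsq : (G.cutoff o r x - G.cutoff o r y) ^ 2 ≤ (r : ℝ)⁻¹ ^ 2 :=
          sq_le_sq.2 ((abs_cutoff_sub_le hconn o r hxy).trans (le_abs_self _))
        have hmax : max (h x) (h y) ^ p ≤ F x + F y := by
          rcases max_choice (h x) (h y) with e | e <;> rw [e]
          · rw [← hFx]; linarith [hF0 y]
          · rw [← hFy]; linarith [hF0 x]
        rw [mul_comm]
        exact mul_le_mul hsq hmax (Real.rpow_nonneg ((hh x).trans (le_max_left _ _)) p)
          (sq_nonneg _)
    · rw [weight_eq_zero hxy, zero_mul, zero_mul]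
  have hone : ∑ x ∈ S, ∑ y ∈ S, G.weight x y * ((r : ℝ)⁻¹ ^ 2 * F x) ≤
      (r : ℝ)⁻¹ ^ 2 * ∑ x ∈ A, G.vertexWeight x * h x ^ p := by
    calc _ = (r : ℝ)⁻¹ ^ 2 * ∑ x ∈ S, (∑ y ∈ S, G.weight x y) * F x := by
          rw [Finset.mul_sum]
          refine Finset.sum_congr rfl fun x _ => ?_
          rw [← Finset.sum_mul]; ring
      _ ≤ (r : ℝ)⁻¹ ^ 2 * ∑ x ∈ S, G.vertexWeight x * F x := by
          refine mul_le_mul_of_nonneg_left (Finset.sum_le_sum fun x _ => ?_) (sq_nonneg _)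
          exact mul_le_mul_of_nonneg_right (sum_weight_le_vertexWeight hfin x S) (hF0 x)
      _ ≤ (r : ℝ)⁻¹ ^ 2 * ∑ x ∈ S ∪ A, G.vertexWeight x * F x := by
          refine mul_le_mul_of_nonneg_left (Finset.sum_le_sum_of_subset_of_nonneg
            Finset.subset_union_left fun x _ _ => ?_) (sq_nonneg _)
          exact mul_nonneg (vertexWeight_nonneg x) (hF0 x)
      _ = (r : ℝ)⁻¹ ^ 2 * ∑ x ∈ A, G.vertexWeight x * h x ^ p := by
          rw [← Finset.sum_subset (Finset.subset_union_right (s₁ := S)) fun x _ hx => by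
            simp [hF, hx]]
          congr 1
          exact Finset.sum_congr rfl fun x hx => by simp [hF, hx]
  have htwo : ∑ x ∈ S, ∑ y ∈ S, G.weight x y * ((r : ℝ)⁻¹ ^ 2 * F y) =
      ∑ x ∈ S, ∑ y ∈ S, G.weight x y * ((r : ℝ)⁻¹ ^ 2 * F x) := by
    rw [Finset.sum_comm]
    exact Finset.sum_congr rfl fun x _ => Finset.sum_congr rfl fun y _ => by rw [G.weight_symm]
  have := Finset.sum_le_sum fun x (_ : x ∈ S) => Finset.sum_le_sum fun y (_ : y ∈ S) => hpt x y
  simp only [Finset.sum_add_distrib] at this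
  rw [htwo] at this
  linarith

/-! ### The Caccioppoli inequality -/

/-- Tangent line bound at `a` for the convex function `t ↦ t ^ (1 - s)`. -/
lemma rpow_one_sub_tangent {a b s : ℝ} (ha : 0 < a) (hb : 0 < b) (hs : 1 < s) :
    (s - 1) * a ^ (-s) * (a - b) ≤ b ^ (1 - s) - a ^ (1 - s) := by
  have hs0 : 0 < s := by linarith
  have h := Real.geom_mean_le_arith_mean2_weighted (w₁ := 1 / s) (w₂ := (s - 1) / s)
    (p₁ := b ^ (1 - s)) (p₂ := a ^ (-s) * b) (by positivity) (div_nonneg (by linarith) hs0.le)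
    (by positivity) (by positivity) (by field_simp; ring)
  have e1 : (b ^ (1 - s)) ^ (1 / s) * (a ^ (-s) * b) ^ ((s - 1) / s) = a ^ (1 - s) := by
    rw [Real.mul_rpow (by positivity) hb.le, ← Real.rpow_mul hb.le, ← Real.rpow_mul ha.le,
      mul_left_comm, ← Real.rpow_add hb]
    have e : (1 - s) * (1 / s) + (s - 1) / s = 0 := by field_simp; ring
    have e' : -s * ((s - 1) / s) = 1 - s := by field_simp; ring
    rw [e, e', Real.rpow_zero, mul_one]
  have e2 : a ^ (1 - s) = a * a ^ (-s) := by
    rw [sub_eq_add_neg, Real.rpow_add ha, Real.rpow_one]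
  rw [e1] at h
  have h' := mul_le_mul_of_nonneg_left h hs0.le
  have e3 : s * (1 / s * b ^ (1 - s) + (s - 1) / s * (a ^ (-s) * b)) =
      b ^ (1 - s) + (s - 1) * (a ^ (-s) * b) := by field_simp
  rw [e3] at h'
  rw [e2] at h' ⊢
  linarith

/-- The Caccioppoli estimate on a single edge. With `b ≤ a`, the good term comes from
`b ^ (1 - s) - a ^ (1 - s)` and carries the cutoff `β` at the lower value; half of it absorbs the
cross term `2 β (α - β)`. -/
lemma caccioppoli_pointwise_of_le {a b α β s : ℝ} (hb : 0 < b) (hab : b ≤ a) (hs : 1 < s) :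
    (a - b) * (a ^ (1 - s) * α ^ 2 - b ^ (1 - s) * β ^ 2) ≤
      (1 + 2 / (s - 1)) * (a ^ (2 - s) * (α - β) ^ 2) -
        (s - 1) / 2 * ((a - b) ^ 2 * a ^ (-s) * β ^ 2) := by
  have ha : 0 < a := hb.trans_le hab
  have hs1 : 0 < s - 1 := by linarith
  have htan := mul_le_mul_of_nonneg_left (rpow_one_sub_tangent ha hb hs)
    (mul_nonneg (sub_nonneg.2 hab) (sq_nonneg β))
  have e1 : a ^ (1 - s) = a * a ^ (-s) := by
    rw [sub_eq_add_neg, Real.rpow_add ha, Real.rpow_one]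
  have e2 : a ^ (2 - s) = a ^ 2 * a ^ (-s) := by
    rw [sub_eq_add_neg, Real.rpow_add ha, Real.rpow_two]
  have hpoly : (a - b) * a * (α ^ 2 - β ^ 2) ≤
      (1 + 2 / (s - 1)) * (a ^ 2 * (α - β) ^ 2) + (s - 1) / 2 * ((a - b) ^ 2 * β ^ 2) := by
    have h1 : (a - b) * a * (α - β) ^ 2 ≤ a ^ 2 * (α - β) ^ 2 :=
      mul_le_mul_of_nonneg_right (by nlinarith) (sq_nonneg _)
    have h2 : 2 * ((a - b) * β) * (a * (α - β)) ≤
        2 / (s - 1) * (a * (α - β)) ^ 2 + (s - 1) / 2 * ((a - b) * β) ^ 2 := by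
      have h3 : 0 ≤ (2 / (s - 1)) * (a * (α - β) - (s - 1) / 2 * ((a - b) * β)) ^ 2 := by positivity
      have e : (2 / (s - 1)) * (a * (α - β) - (s - 1) / 2 * ((a - b) * β)) ^ 2 =
          2 / (s - 1) * (a * (α - β)) ^ 2 + (s - 1) / 2 * ((a - b) * β) ^ 2 -
            2 * ((a - b) * β) * (a * (α - β)) := by
        field_simp; ring
      linarith
    nlinarith
  have hpoly' := mul_le_mul_of_nonneg_right hpoly (Real.rpow_nonneg ha.le (-s))
  rw [e1] at htan ⊢
  rw [e2]
  nlinarith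

lemma caccioppoli_pointwise {a b α β s : ℝ} (ha : 0 < a) (hb : 0 < b) (hα : 0 ≤ α) (hβ : 0 ≤ β)
    (hs : 1 < s) :
    (a - b) * (a ^ (1 - s) * α ^ 2 - b ^ (1 - s) * β ^ 2) ≤
      (1 + 2 / (s - 1)) * (max a b ^ (2 - s) * (α - β) ^ 2) -
        (s - 1) / 2 * ((a - b) ^ 2 * max a b ^ (-s) * min α β ^ 2) := by
  have hs1 : 0 < s - 1 := by linarith
  wlog hab : b ≤ a generalizing a b α β
  · have := this hb ha hβ hα (le_of_not_ge hab)
    rw [max_comm, min_comm] at this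
    linarith
  rw [max_eq_left hab]
  refine (caccioppoli_pointwise_of_le hb hab hs).trans (sub_le_sub_left ?_ _)
  have : min α β ^ 2 ≤ β ^ 2 := pow_le_pow_left₀ (le_min hα hβ) (min_le_right _ _) 2
  have hc : 0 ≤ (a - b) ^ 2 * a ^ (-s) := mul_nonneg (sq_nonneg _) (Real.rpow_nonneg ha.le _)
  gcongr

/-- Caccioppoli inequality: a function `h` that is positive and superharmonic on `B(o, N)` is tested
against `h ^ (1 - s) η ^ 2`, with `η` a cutoff supported in the ball. -/
lemma caccioppoli [Infinite V] (hconn : G.Connected) (hfin : G.LocallyFinite) {o : V} {N r : ℕ}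
    (hr : 0 < r) (hrN : 2 * r ≤ N) {h : V → ℝ} {Ω S : Finset V}
    (hΩ : ∀ x, x ∈ Ω ↔ G.toSimpleGraph.dist o x ≤ N) (hΩS : Ω ⊆ S)
    (hS : ∀ x ∈ Ω, ∀ y, G.Adj x y → y ∈ S) (hpos : ∀ x ∈ Ω, 0 < h x) (hh : ∀ x, 0 ≤ h x)
    (hsuper : ∀ x ∈ Ω, 0 ≤ -G.laplacian h x) {s : ℝ} (hs : 1 < s) :
    (s - 1) / 2 * ∑ x ∈ S, ∑ y ∈ S, G.weight x y * ((h x - h y) ^ 2 * max (h x) (h y) ^ (-s) *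
        min (G.cutoff o r x) (G.cutoff o r y) ^ 2) ≤
      (1 + 2 / (s - 1)) * ∑ x ∈ S, ∑ y ∈ S, G.weight x y *
        (max (h x) (h y) ^ (2 - s) * (G.cutoff o r x - G.cutoff o r y) ^ 2) := by
  set η := G.cutoff o r with hη
  have hη0 : ∀ x, ¬ G.toSimpleGraph.dist o x < 2 * r → η x = 0 := fun x hx =>
    cutoff_eq_zero hr (not_lt.1 hx)
  have hgreen := green_formula hconn hfin h (ψ := fun x => h x ^ (1 - s) * η x ^ 2) hΩS hS
    (fun x hx => by
      have hx' : ¬ G.toSimpleGraph.dist o x < 2 * r := fun hlt => hx ((hΩ x).2 (by omega))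
      simp [hη0 x hx'])
  have hge : 0 ≤ 2 * ∑ x ∈ Ω, h x ^ (1 - s) * η x ^ 2 * (G.vertexWeight x * -G.laplacian h x) :=
    mul_nonneg zero_le_two (Finset.sum_nonneg fun x hx => mul_nonneg
      (mul_nonneg (Real.rpow_nonneg (hh x) _) (sq_nonneg _))
      (mul_nonneg (vertexWeight_nonneg x) (hsuper x hx)))
  have hpt : ∀ x y, G.weight x y * ((h x - h y) * (h x ^ (1 - s) * η x ^ 2 -
      h y ^ (1 - s) * η y ^ 2)) ≤
      (1 + 2 / (s - 1)) * (G.weight x y * (max (h x) (h y) ^ (2 - s) * (η x - η y) ^ 2)) -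
      (s - 1) / 2 * (G.weight x y * ((h x - h y) ^ 2 * max (h x) (h y) ^ (-s) *
        min (η x) (η y) ^ 2)) := fun x y => by
    by_cases hxy : G.Adj x y
    · by_cases hsupp : η x = 0 ∧ η y = 0
      · simp [hsupp.1, hsupp.2]
      · -- An edge that meets the support of `η` has both ends in the ball, where `h > 0`.
        have h1 := dist_le_dist_add_one hconn o hxy
        have h2 := dist_le_dist_add_one hconn o (G.adj_symm hxy)
        have hlt : G.toSimpleGraph.dist o x < 2 * r ∨ G.toSimpleGraph.dist o y < 2 * r := by
          by_contra! hc
          exact hsupp ⟨hη0 x (not_lt.2 hc.1), hη0 y (not_lt.2 hc.2)⟩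
        have := caccioppoli_pointwise (hpos x ((hΩ x).2 (by omega))) (hpos y ((hΩ y).2 (by omega)))
          (cutoff_nonneg (G := G) o r x) (cutoff_nonneg (G := G) o r y) hs
        have := mul_le_mul_of_nonneg_left this (G.weight_nonneg x y)
        rw [← hη] at this
        linarith
    · simp [weight_eq_zero hxy]
  have hsum := Finset.sum_le_sum fun x (_ : x ∈ S) => Finset.sum_le_sum fun y (_ : y ∈ S) => hpt x y
  simp only [Finset.sum_sub_distrib, ← Finset.mul_sum] at hsum
  rw [hgreen] at hsum
  linarith

/-! ### The flux through an annulus -/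

/-- The total flux of the Green function, tested with the cutoff of radius `r` and estimated by
Cauchy–Schwarz and the Caccioppoli inequality with the cutoff of radius `2 r`. -/
lemma flux_sq_mul_le [Infinite V] (hconn : G.Connected) (hfin : G.LocallyFinite) {o : V} {N r : ℕ}
    (hr : 0 < r) (hrN : 4 * r ≤ N) {h : V → ℝ} {Ω A : Finset V}
    (hΩ : ∀ x, x ∈ Ω ↔ G.toSimpleGraph.dist o x ≤ N)
    (hA : ∀ x, x ∈ A ↔ r ≤ G.toSimpleGraph.dist o x ∧ G.toSimpleGraph.dist o x ≤ 4 * r)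
    (hpos : ∀ x ∈ Ω, 0 < h x) (hh : ∀ x, 0 ≤ h x) (ho : 0 ≤ -G.laplacian h o)
    (hharm : ∀ x ∈ Ω, x ≠ o → -G.laplacian h x = 0) {s : ℝ} (hs : 1 < s) :
    (G.vertexWeight o * -G.laplacian h o) ^ 2 * (r : ℝ) ^ 4 ≤
      (1 + 2 / (s - 1)) / (2 * (s - 1)) * ((∑ x ∈ A, G.vertexWeight x * h x ^ (2 - s)) *
        ∑ x ∈ A, G.vertexWeight x * h x ^ s) := by
  have hs1 : 0 < s - 1 := by linarith
  have hr0 : (0 : ℝ) < r := by exact_mod_cast hr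
  obtain ⟨S, hSmem⟩ : ∃ S : Finset V, ∀ x, x ∈ S ↔ G.toSimpleGraph.dist o x ≤ N + 1 :=
    ⟨(finite_closedBall hconn hfin o (N + 1)).toFinset, fun x => by simp [closedBall]⟩
  have hΩS : Ω ⊆ S := fun x hx => (hSmem x).2 (((hΩ x).1 hx).trans (Nat.le_succ N))
  have hS : ∀ x ∈ Ω, ∀ y, G.Adj x y → y ∈ S := fun x hx y hy =>
    (hSmem y).2 ((dist_le_dist_add_one hconn o hy).trans (Nat.succ_le_succ ((hΩ x).1 hx)))
  have hoΩ : o ∈ Ω := (hΩ o).2 (by simp)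
  have hsuper : ∀ x ∈ Ω, 0 ≤ -G.laplacian h x := fun x hx => by
    by_cases hxo : x = o
    · rwa [hxo]
    · rw [hharm x hx hxo]
  have hcacc := caccioppoli hconn hfin (o := o) (N := N) (r := 2 * r) (by omega) (by omega)
    hΩ hΩS hS hpos hh hsuper hs
  have hE := sum_weight_mul_rpow_mul_cutoff_sub_sq_le hconn hfin o (r := 2 * r) (by omega) hh (2 - s)
    (S := S) (A := A) (fun x h1 h2 => (hA x).2 ⟨by omega, by omega⟩)
  have hF := sum_weight_mul_rpow_mul_cutoff_sub_sq_le hconn hfin o hr hh s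
    (S := S) (A := A) (fun x h1 h2 => (hA x).2 ⟨by omega, by omega⟩)
  set D := ∑ x ∈ S, ∑ y ∈ S, G.weight x y * ((h x - h y) ^ 2 * max (h x) (h y) ^ (-s) *
        min (G.cutoff o (2 * r) x) (G.cutoff o (2 * r) y) ^ 2) with hD
  set F := ∑ x ∈ S, ∑ y ∈ S, G.weight x y *
        (max (h x) (h y) ^ s * (G.cutoff o r x - G.cutoff o r y) ^ 2) with hFdef
  set X := ∑ x ∈ A, G.vertexWeight x * h x ^ (2 - s)
  set Y := ∑ x ∈ A, G.vertexWeight x * h x ^ s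
  have hX0 : 0 ≤ X := Finset.sum_nonneg fun x _ =>
    mul_nonneg (vertexWeight_nonneg x) (Real.rpow_nonneg (hh x) _)
  have hY0 : 0 ≤ Y := Finset.sum_nonneg fun x _ =>
    mul_nonneg (vertexWeight_nonneg x) (Real.rpow_nonneg (hh x) _)
  have hmax0 : ∀ x y, 0 ≤ max (h x) (h y) := fun x y => (hh x).trans (le_max_left _ _)
  have hD0 : ∀ x y, 0 ≤ G.weight x y * ((h x - h y) ^ 2 * max (h x) (h y) ^ (-s) *
        min (G.cutoff o (2 * r) x) (G.cutoff o (2 * r) y) ^ 2) := fun x y =>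
    mul_nonneg (G.weight_nonneg _ _) (mul_nonneg (mul_nonneg (sq_nonneg _)
      (Real.rpow_nonneg (hmax0 x y) _)) (sq_nonneg _))
  have hF0 : ∀ x y, 0 ≤ G.weight x y *
        (max (h x) (h y) ^ s * (G.cutoff o r x - G.cutoff o r y) ^ 2) := fun x y =>
    mul_nonneg (G.weight_nonneg _ _) (mul_nonneg (Real.rpow_nonneg (hmax0 x y) _) (sq_nonneg _))
  have hDnn : 0 ≤ D := Finset.sum_nonneg fun x _ => Finset.sum_nonneg fun y _ => hD0 x y
  have hgreen := green_formula hconn hfin h (ψ := G.cutoff o r) hΩS hS (fun x hx => by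
    have : ¬ G.toSimpleGraph.dist o x ≤ N := fun hle => hx ((hΩ x).2 hle)
    exact cutoff_eq_zero hr (by omega))
  rw [Finset.sum_eq_single_of_mem o hoΩ (fun x hx hxo => by rw [hharm x hx hxo]; ring),
    cutoff_eq_one hr (by simp), one_mul] at hgreen
  have hCS : (2 * (G.vertexWeight o * -G.laplacian h o)) ^ 2 ≤ D * F := by
    rw [← hgreen, hD, hFdef]
    simp only [← Finset.sum_product']
    refine Finset.sum_sq_le_sum_mul_sum_of_sq_le_mul _ (fun p _ => hD0 p.1 p.2)
      (fun p _ => hF0 p.1 p.2) ?_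
    rintro ⟨x, y⟩ -
    dsimp only
    by_cases hxy : G.Adj x y
    · by_cases hne : G.cutoff o r x = G.cutoff o r y
      · simp [hne]
      · refine le_of_eq ?_
        have hx := (mem_annulus_of_cutoff_ne hconn hr hxy hne).2
        have hy := (mem_annulus_of_cutoff_ne hconn hr (G.adj_symm hxy) (Ne.symm hne)).2
        have hm : 0 < max (h x) (h y) := lt_max_of_lt_left (hpos x ((hΩ x).2 (by omega)))
        have e : max (h x) (h y) ^ (-s) * max (h x) (h y) ^ s = 1 := by
          rw [← Real.rpow_add hm, neg_add_cancel, Real.rpow_zero]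
        rw [cutoff_eq_one (r := 2 * r) (by omega) hx, cutoff_eq_one (r := 2 * r) (by omega) hy,
          min_self]
        linear_combination -(G.weight x y ^ 2 * (h x - h y) ^ 2 *
          (G.cutoff o r x - G.cutoff o r y) ^ 2) * e
    · simp [weight_eq_zero hxy]
  have hD' : D ≤ 2 / (s - 1) * ((1 + 2 / (s - 1)) * (2 * (((2 * r : ℕ) : ℝ)⁻¹ ^ 2 * X))) := by
    have h1 := hcacc.trans (mul_le_mul_of_nonneg_left hE (by positivity))
    have h2 := mul_le_mul_of_nonneg_left h1 (by positivity : (0 : ℝ) ≤ 2 / (s - 1))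
    have e : 2 / (s - 1) * ((s - 1) / 2 * D) = D := by field_simp
    rwa [e] at h2
  have hfinal := hCS.trans (mul_le_mul hD' hF (Finset.sum_nonneg fun x _ =>
    Finset.sum_nonneg fun y _ => hF0 x y) (hDnn.trans hD'))
  have hmul := mul_le_mul_of_nonneg_right hfinal (by positivity : (0 : ℝ) ≤ (r : ℝ) ^ 4 / 4)
  calc _ = (2 * (G.vertexWeight o * -G.laplacian h o)) ^ 2 * ((r : ℝ) ^ 4 / 4) := by ring
    _ ≤ _ := hmul
    _ = _ := by
      push_cast
      field_simp
      ring

/-- Weighted Hölder inequality between the exponents `p ≤ q`. -/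
lemma sum_mul_rpow_le_rpow_mul_rpow {ι : Type*} (A : Finset ι) {w f : ι → ℝ}
    (hw : ∀ i, 0 ≤ w i) (hf : ∀ i, 0 ≤ f i) {p q : ℝ} (hp : 0 < p) (hpq : p ≤ q) :
    ∑ i ∈ A, w i * f i ^ p ≤
      (∑ i ∈ A, w i) ^ (1 - p / q) * (∑ i ∈ A, w i * f i ^ q) ^ (p / q) := by
  have h := Real.inner_le_weight_mul_Lp_of_nonneg A (p := q / p) ((one_le_div hp).2 hpq) w
    (fun i => f i ^ p) hw (fun i => Real.rpow_nonneg (hf i) p)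
  have e : ∀ i, (f i ^ p) ^ (q / p) = f i ^ q := fun i => by
    rw [← Real.rpow_mul (hf i), mul_div_cancel₀ _ hp.ne']
  simpa only [e, inv_div] using h

/-- Lower bound for the mass of `h ^ q` on an annulus, by Hölder's inequality. The constant depends
on the exponents and the flux of `h` only. -/
lemma mul_rpow_le_sum_mul_rpow [Infinite V] (hconn : G.Connected) (hfin : G.LocallyFinite) {q s : ℝ}
    (hs : 1 < s) (hs2 : s < 2) (hsq : s ≤ q) {o : V} {N r : ℕ}
    (hr : 0 < r) (hrN : 4 * r ≤ N) {h : V → ℝ} {Ω A : Finset V}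
    (hΩ : ∀ x, x ∈ Ω ↔ G.toSimpleGraph.dist o x ≤ N)
    (hA : ∀ x, x ∈ A ↔ r ≤ G.toSimpleGraph.dist o x ∧ G.toSimpleGraph.dist o x ≤ 4 * r)
    (hpos : ∀ x ∈ Ω, 0 < h x) (hh : ∀ x, 0 ≤ h x) (ho : 0 ≤ -G.laplacian h o)
    (hharm : ∀ x ∈ Ω, x ≠ o → -G.laplacian h x = 0) :
    ((G.vertexWeight o * -G.laplacian h o) ^ 2 / ((1 + 2 / (s - 1)) / (2 * (s - 1)))) ^ (q / 2) *
      (r : ℝ) ^ (2 * q) ≤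
      (∑ x ∈ A, G.vertexWeight x * h x ^ q) * (∑ x ∈ A, G.vertexWeight x) ^ (q - 1) := by
  have hs1 : 0 < s - 1 := by linarith
  have hq0 : 0 < q := by linarith
  have hflux := flux_sq_mul_le hconn hfin hr hrN hΩ hA hpos hh ho hharm hs
  have hX := sum_mul_rpow_le_rpow_mul_rpow A (w := G.vertexWeight) (f := h) (q := q) (p := 2 - s)
    vertexWeight_nonneg hh (by linarith) (by linarith)
  have hY := sum_mul_rpow_le_rpow_mul_rpow A (w := G.vertexWeight) (f := h) (q := q) (p := s)
    vertexWeight_nonneg hh (by linarith) hsq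
  set K := (1 + 2 / (s - 1)) / (2 * (s - 1))
  have hK : 0 < K := by positivity
  set W := ∑ x ∈ A, G.vertexWeight x * h x ^ q
  set M := ∑ x ∈ A, G.vertexWeight x
  have hW : 0 ≤ W := Finset.sum_nonneg fun x _ =>
    mul_nonneg (vertexWeight_nonneg x) (Real.rpow_nonneg (hh x) _)
  have hM : 0 ≤ M := Finset.sum_nonneg fun x _ => vertexWeight_nonneg x
  have hY0 : 0 ≤ ∑ x ∈ A, G.vertexWeight x * h x ^ s := Finset.sum_nonneg fun x _ =>
    mul_nonneg (vertexWeight_nonneg x) (Real.rpow_nonneg (hh x) _)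
  have hsplit : M ^ (1 - (2 - s) / q) * W ^ ((2 - s) / q) * (M ^ (1 - s / q) * W ^ (s / q)) =
      M ^ (2 - 2 / q) * W ^ (2 / q) := by
    have h1 : 0 ≤ 1 - (2 - s) / q := sub_nonneg.2 ((div_le_one hq0).2 (by linarith))
    have h2 : 0 ≤ 1 - s / q := sub_nonneg.2 ((div_le_one hq0).2 hsq)
    have h3 : 0 ≤ (2 - s) / q := div_nonneg (by linarith) hq0.le
    have h4 : 0 ≤ s / q := div_nonneg (by linarith) hq0.le
    rw [mul_mul_mul_comm, ← Real.rpow_add_of_nonneg hM h1 h2, ← Real.rpow_add_of_nonneg hW h3 h4]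
    congr 2 <;> ring
  have hXY := mul_le_mul hX hY hY0
    (mul_nonneg (Real.rpow_nonneg hM _) (Real.rpow_nonneg hW _))
  rw [hsplit] at hXY
  have hmain : (G.vertexWeight o * -G.laplacian h o) ^ 2 / K * (r : ℝ) ^ 4 ≤
      M ^ (2 - 2 / q) * W ^ (2 / q) := by
    rw [div_mul_eq_mul_div, div_le_iff₀ hK, mul_comm _ K]
    exact hflux.trans (mul_le_mul_of_nonneg_left hXY hK.le)
  have hpow := Real.rpow_le_rpow (by positivity) hmain (by positivity : 0 ≤ q / 2)
  rw [Real.mul_rpow (by positivity) (by positivity),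
    Real.mul_rpow (Real.rpow_nonneg hM _) (Real.rpow_nonneg hW _), ← Real.rpow_mul hM,
    ← Real.rpow_mul hW, ← Real.rpow_natCast (r : ℝ), ← Real.rpow_mul (Nat.cast_nonneg r)] at hpow
  have e1 : ((4 : ℕ) : ℝ) * (q / 2) = 2 * q := by push_cast; ring
  have e2 : (2 - 2 / q) * (q / 2) = q - 1 := by field_simp
  have e3 : 2 / q * (q / 2) = 1 := by field_simp
  rw [e1, e2, e3, Real.rpow_one, mul_comm (M ^ (q - 1))] at hpow
  exact hpow

/-! ### Ball volumes and dyadic summation -/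

lemma ballVolume_eq_sum {o : V} {n : ℕ} {B : Finset V}
    (hB : ∀ x, x ∈ B ↔ G.toSimpleGraph.dist o x ≤ n) :
    G.ballVolume o n = ∑ x ∈ B, G.vertexWeight x := by
  have : G.closedBall o n = (B : Set V) := by ext x; exact (hB x).symm
  rw [ballVolume, this, finsum_mem_coe_finset]

lemma ballVolume_mono (hconn : G.Connected) (hfin : G.LocallyFinite) (o : V) :
    Monotone (G.ballVolume o) := fun m n hmn => by
  rw [ballVolume_eq_sum (B := (finite_closedBall hconn hfin o m).toFinset) (by simp [closedBall]),
    ballVolume_eq_sum (B := (finite_closedBall hconn hfin o n).toFinset) (by simp [closedBall])]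
  refine Finset.sum_le_sum_of_subset_of_nonneg (fun x hx => ?_) fun x _ _ => vertexWeight_nonneg x
  simp only [Set.Finite.mem_toFinset] at hx ⊢
  exact le_trans hx hmn

lemma ballVolume_pos [Infinite V] (hconn : G.Connected) (hfin : G.LocallyFinite) (o : V) (n : ℕ) :
    0 < G.ballVolume o n := by
  rw [ballVolume_eq_sum (B := (finite_closedBall hconn hfin o n).toFinset) (by simp [closedBall])]
  exact Finset.sum_pos (fun x _ => vertexWeight_pos hconn hfin x) ⟨o, by simp [closedBall]⟩

/-- A point lies in at most three of the dyadic annuli `2 ^ k ≤ d ≤ 4 * 2 ^ k`. -/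
lemma card_filter_dyadic_le (K d : ℕ) :
    ((Finset.range K).filter fun k => 2 ^ k ≤ d ∧ d ≤ 4 * 2 ^ k).card ≤ 3 := by
  have hsub : ((Finset.range K).filter fun k => 2 ^ k ≤ d ∧ d ≤ 4 * 2 ^ k) ⊆
      Finset.Icc (Nat.log 2 d - 2) (Nat.log 2 d) := fun k hk => by
    obtain ⟨-, h1, h2⟩ := Finset.mem_filter.1 hk
    have h3 : k ≤ Nat.log 2 d := Nat.le_log_of_pow_le one_lt_two h1
    have h4 : Nat.log 2 d ≤ k + 2 := by
      calc Nat.log 2 d ≤ Nat.log 2 (2 ^ (k + 2)) := Nat.log_mono_right (by rw [pow_add]; omega)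
        _ = k + 2 := Nat.log_pow one_lt_two _
    exact Finset.mem_Icc.2 ⟨by omega, h3⟩
  refine (Finset.card_le_card hsub).trans ?_
  rw [Nat.card_Icc]; omega

/-- A positive solution bounds the dyadic form of the volume series, uniformly. -/
lemma exists_dyadic_sum_bound [Infinite V] (hconn : G.Connected) (hfin : G.LocallyFinite)
    {q : ℝ} (hq : 1 < q) {u : V → ℝ} (hu : ∀ x, 0 < u x)
    (hsol : ∀ x, u x ^ q ≤ -G.laplacian u x) (o : V) :
    ∃ C : ℝ, ∀ K : ℕ, ∑ k ∈ Finset.range K,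
      ((2 : ℝ) ^ k) ^ (2 * q) / G.ballVolume o (2 ^ (k + 2)) ^ (q - 1) ≤ C := by
  classical
  have hq1 : 0 < q - 1 := by linarith
  obtain ⟨s, hs, hs'⟩ := exists_between (lt_min hq one_lt_two)
  have hsq : s ≤ q := hs'.le.trans (min_le_left _ _)
  have hs2 : s < 2 := hs'.trans_le (min_le_right _ _)
  have hs1 : 0 < s - 1 := by linarith
  have hμ := vertexWeight_pos hconn hfin o
  have hκ : 0 < u o ^ q := Real.rpow_pos_of_pos (hu o) q
  set c := ((G.vertexWeight o * u o ^ q) ^ 2 / ((1 + 2 / (s - 1)) / (2 * (s - 1)))) ^ (q / 2)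
    with hc
  have hc0 : 0 < c := by positivity
  refine ⟨3 * (q * (G.vertexWeight o * u o ^ q) / (q - 1)) / c, fun K => ?_⟩
  rw [le_div_iff₀ hc0, Finset.sum_mul]
  obtain ⟨N, hN⟩ : ∃ N : ℕ, ∀ k < K, 4 * 2 ^ k ≤ N := ⟨4 * 2 ^ K, fun k hk =>
    Nat.mul_le_mul_left 4 (Nat.pow_le_pow_right two_pos hk.le)⟩
  obtain ⟨Ω, hΩ⟩ : ∃ Ω : Finset V, ∀ x, x ∈ Ω ↔ G.toSimpleGraph.dist o x ≤ N :=
    ⟨(finite_closedBall hconn hfin o N).toFinset, fun x => by simp [closedBall]⟩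
  obtain ⟨S, hSmem⟩ : ∃ S : Finset V, ∀ x, x ∈ S ↔ G.toSimpleGraph.dist o x ≤ N + 1 :=
    ⟨(finite_closedBall hconn hfin o (N + 1)).toFinset, fun x => by simp [closedBall]⟩
  have hΩS : Ω ⊆ S := fun x hx => (hSmem x).2 (((hΩ x).1 hx).trans (Nat.le_succ N))
  have hS : ∀ x ∈ Ω, ∀ y, G.Adj x y → y ∈ S := fun x hx y hy =>
    (hSmem y).2 ((dist_le_dist_add_one hconn o hy).trans (Nat.succ_le_succ ((hΩ x).1 hx)))
  have hoΩ : o ∈ Ω := (hΩ o).2 (by simp)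
  obtain ⟨h, hout, hlap⟩ := exists_dirichlet_solution hconn hfin Ω
    (fun x => if x = o then u o ^ q else 0)
  have hlapo : -G.laplacian h o = u o ^ q := by simpa using hlap o hoΩ
  have hharm : ∀ x ∈ Ω, x ≠ o → -G.laplacian h x = 0 := fun x hx hxo => by
    simpa [hxo] using hlap x hx
  have hsuper : ∀ x ∈ Ω, 0 ≤ -G.laplacian h x := fun x hx => by
    rw [hlap x hx]; split_ifs
    · exact hκ.le
    · exact le_rfl
  have hpos : ∀ x ∈ Ω, 0 < h x := fun x hx =>
    dirichlet_solution_pos_on_ball hconn hfin (o := o) (N := N)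
      (fun x hx => hout x fun hx' => hx ((hΩ x).1 hx')) (fun x hx => hsuper x ((hΩ x).2 hx))
      (hlapo ▸ hκ) x ((hΩ x).1 hx)
  have hh : ∀ x, 0 ≤ h x := nonneg_of_superharmonicOn hconn hfin Ω (fun x hx => (hout x hx).ge) hsuper
  have hle : h o ≤ u o := by
    have := nonneg_of_superharmonicOn hconn hfin (f := u + -h) Ω
      (fun x hx => by simpa [hout x hx] using (hu x).le)
      (fun x hx => by
        rw [laplacian_add hfin, laplacian_neg hfin]
        have h1 := hsol x
        have h2 := hlap x hx
        have h3 : (if x = o then u o ^ q else 0) ≤ u x ^ q := by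
          split_ifs with hxo
          · rw [hxo]
          · exact Real.rpow_nonneg (hu x).le q
        linarith) o
    simp only [Pi.add_apply, Pi.neg_apply] at this
    linarith
  have hmass := sum_vertexWeight_mul_rpow_le hconn hfin hq hu hsol hh hΩS hS hout hoΩ
    (hlapo ▸ hκ.le) hharm hle
  rw [hlapo] at hmass
  have hmass' : ∑ x ∈ Ω, G.vertexWeight x * h x ^ q ≤
      q * (G.vertexWeight o * u o ^ q) / (q - 1) := by
    rw [le_div_iff₀ hq1]; linarith
  have hann : ∀ k ∈ Finset.range K,
      ((2 : ℝ) ^ k) ^ (2 * q) / G.ballVolume o (2 ^ (k + 2)) ^ (q - 1) * c ≤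
      ∑ x ∈ Ω, if 2 ^ k ≤ G.toSimpleGraph.dist o x ∧ G.toSimpleGraph.dist o x ≤ 4 * 2 ^ k
        then G.vertexWeight x * h x ^ q else 0 := fun k hk => by
    have hkN := hN k (Finset.mem_range.1 hk)
    rw [← Finset.sum_filter]
    set A := Ω.filter fun x =>
      2 ^ k ≤ G.toSimpleGraph.dist o x ∧ G.toSimpleGraph.dist o x ≤ 4 * 2 ^ k with hAdef
    have hA : ∀ x, x ∈ A ↔ 2 ^ k ≤ G.toSimpleGraph.dist o x ∧
        G.toSimpleGraph.dist o x ≤ 4 * 2 ^ k := fun x => by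
      rw [hAdef, Finset.mem_filter, hΩ]
      exact ⟨fun h => h.2, fun h => ⟨h.2.trans hkN, h⟩⟩
    have hbound := mul_rpow_le_sum_mul_rpow hconn hfin hs hs2 hsq (Nat.two_pow_pos k) hkN hΩ hA hpos
      hh (hlapo ▸ hκ.le) hharm
    rw [hlapo, ← hc] at hbound
    have hW : 0 ≤ ∑ x ∈ A, G.vertexWeight x * h x ^ q := Finset.sum_nonneg fun x _ =>
      mul_nonneg (vertexWeight_nonneg x) (Real.rpow_nonneg (hh x) _)
    have hvol : ∑ x ∈ A, G.vertexWeight x ≤ G.ballVolume o (2 ^ (k + 2)) := by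
      rw [ballVolume_eq_sum (B := (finite_closedBall hconn hfin o (2 ^ (k + 2))).toFinset)
        (by simp [closedBall])]
      refine Finset.sum_le_sum_of_subset_of_nonneg (fun x hx => ?_)
        fun x _ _ => vertexWeight_nonneg x
      have h4 : 2 ^ (k + 2) = 4 * 2 ^ k := by rw [pow_add]; ring
      simp only [closedBall, Set.Finite.mem_toFinset]
      exact ((hA x).1 hx).2.trans h4.ge
    have hM := Real.rpow_le_rpow (Finset.sum_nonneg fun x _ => vertexWeight_nonneg x) hvol hq1.le
    rw [div_mul_eq_mul_div, div_le_iff₀ (Real.rpow_pos_of_pos (ballVolume_pos hconn hfin o _) _),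
      mul_comm _ c]
    push_cast at hbound
    exact hbound.trans (mul_le_mul_of_nonneg_left hM hW)
  refine (Finset.sum_le_sum hann).trans ?_
  rw [Finset.sum_comm, mul_comm (3 : ℝ)]
  calc _ ≤ ∑ x ∈ Ω, G.vertexWeight x * h x ^ q * 3 := by
        refine Finset.sum_le_sum fun x _ => ?_
        rw [← Finset.sum_filter, Finset.sum_const, nsmul_eq_mul, mul_comm]
        refine mul_le_mul_of_nonneg_left ?_
          (mul_nonneg (vertexWeight_nonneg x) (Real.rpow_nonneg (hh x) _))
        exact_mod_cast card_filter_dyadic_le K _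
    _ ≤ _ := by
        rw [← Finset.sum_mul]
        exact mul_le_mul_of_nonneg_right hmass' (by norm_num)

/-- Comparison of a volume series with its dyadic form. -/
lemma sum_Ico_le_dyadic_sum {q : ℝ} (hq : 1 < q) {v : ℕ → ℝ} (hv : Monotone v)
    (hpos : ∀ n, 0 < v n) (K : ℕ) :
    ∑ n ∈ Finset.Ico 1 (2 ^ K : ℕ), (n : ℝ) ^ (2 * q - 1) / v n ^ (q - 1) ≤
      2 ^ (2 * q - 1) * ∑ k ∈ Finset.range K, ((2 : ℝ) ^ k) ^ (2 * q) / v (2 ^ k) ^ (q - 1) := by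
  induction K with
  | zero => simp
  | succ K ih =>
    rw [← Finset.sum_Ico_consecutive _ (Nat.one_le_two_pow (n := K))
      (Nat.pow_le_pow_right two_pos K.le_succ), Finset.sum_range_succ, mul_add]
    refine add_le_add ih ?_
    have hterm : ∀ n ∈ Finset.Ico (2 ^ K : ℕ) (2 ^ (K + 1)), (n : ℝ) ^ (2 * q - 1) / v n ^ (q - 1) ≤
        ((2 : ℝ) ^ (K + 1)) ^ (2 * q - 1) / v (2 ^ K) ^ (q - 1) := fun n hn => by
      obtain ⟨h1, h2⟩ := Finset.mem_Ico.1 hn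
      have h2' : (n : ℝ) ≤ 2 ^ (K + 1) := by exact_mod_cast h2.le
      refine div_le_div₀ (by positivity)
        (Real.rpow_le_rpow (Nat.cast_nonneg n) h2' (by linarith))
        (Real.rpow_pos_of_pos (hpos _) _)
        (Real.rpow_le_rpow (hpos _).le (hv h1) (by linarith))
    refine (Finset.sum_le_card_nsmul _ _ _ hterm).trans (le_of_eq ?_)
    have hcard : 2 ^ (K + 1) - 2 ^ K = 2 ^ K := by rw [pow_succ]; omega
    have e : ((2 : ℝ) ^ K) ^ (2 * q) = 2 ^ K * ((2 : ℝ) ^ K) ^ (2 * q - 1) := by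
      rw [← Real.rpow_one_add' (by positivity) (by linarith), add_sub_cancel]
    rw [Nat.card_Ico, hcard, nsmul_eq_mul, pow_succ, Real.mul_rpow (by positivity) (by norm_num), e]
    push_cast
    ring

end WeightedGraph

open WeightedGraph in
theorem theorem1p2 {V : Type*} [Infinite V] (G : WeightedGraph V)
    (hconn : G.Connected) (hfin : G.LocallyFinite) (q : ℝ) (hq : 1 < q) (o : V)
    (hvol : Filter.Tendsto
      (fun N : ℕ => ∑ n ∈ Finset.Icc 1 N,
        (n : ℝ) ^ (2 * q - 1) / (G.ballVolume o n) ^ (q - 1))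
      Filter.atTop Filter.atTop)
    (u : V → ℝ) (hu : ∀ x, 0 ≤ u x) (hsol : ∀ x, u x ^ q ≤ -G.laplacian u x) :
    ∀ x, u x = 0 := by
  by_contra! hne
  obtain ⟨z, hz⟩ := hne
  have hpos := pos_of_superharmonic hconn hfin hu
    (fun x => (Real.rpow_nonneg (hu x) q).trans (hsol x)) hz
  obtain ⟨C, hC⟩ := exists_dyadic_sum_bound hconn hfin hq hpos hsol o
  set b : ℕ → ℝ := fun k => ((2 : ℝ) ^ k) ^ (2 * q) / G.ballVolume o (2 ^ k) ^ (q - 1) with hb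
  -- The bound `C` compares the radius `2 ^ k` with the volume at `2 ^ (k + 2)`.
  have hshift : ∀ k, b (k + 2) = (4 : ℝ) ^ (2 * q) *
      (((2 : ℝ) ^ k) ^ (2 * q) / G.ballVolume o (2 ^ (k + 2)) ^ (q - 1)) := fun k => by
    have e : (2 : ℝ) ^ (k + 2) = 4 * 2 ^ k := by rw [pow_add]; ring
    simp only [hb]
    rw [e, Real.mul_rpow (by norm_num) (by positivity), mul_div_assoc]
  obtain ⟨M, hM⟩ := (hvol.eventually_gt_atTop
    (2 ^ (2 * q - 1) * ((4 : ℝ) ^ (2 * q) * C + b 1 + b 0))).exists_forall_of_atTop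
  have hlarge := hM (2 ^ (M + 2) - 1)
    (by have := (Nat.lt_two_pow_self (n := M + 2)); omega)
  have hIcc : Finset.Icc 1 (2 ^ (M + 2) - 1) = Finset.Ico 1 (2 ^ (M + 2)) := by
    ext n
    have := Nat.two_pow_pos (M + 2)
    simp only [Finset.mem_Icc, Finset.mem_Ico]
    omega
  have hcond := sum_Ico_le_dyadic_sum hq (ballVolume_mono hconn hfin o)
    (ballVolume_pos hconn hfin o) (M + 2)
  have hbsum : ∑ k ∈ Finset.range (M + 2), b k ≤ (4 : ℝ) ^ (2 * q) * C + b 1 + b 0 := by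
    rw [Finset.sum_range_succ', Finset.sum_range_succ']
    simp only [add_assoc, Nat.reduceAdd, hshift, zero_add]
    rw [← Finset.mul_sum]
    gcongr
    exact hC M
  have h2 := mul_le_mul_of_nonneg_left hbsum
    (Real.rpow_nonneg (zero_le_two (α := ℝ)) (2 * q - 1))
  rw [hIcc] at hlarge
  exact absurd (hcond.trans h2) (not_le.2 hlarge)
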